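/- Let $U:(0,\infty)^2\to(0,\infty)$, written $U(y,z)$, be homogeneous of degree 1 and twice continuously differentiable with $U_y,U_z>0$, $U_{yy},U_{zz}<0$, $\lim_{y\downarrow 0}U_y(y,z)=\infty$ for every $z>0$ and $\lim_{z\downarrow 0}U_z(y,z)=\infty$ for every $y>0$. Let $a>0$, $b\ge 0$, $0<G_d<G$ and $D>0$. Consider the two-period overlapping generations economy with $t=0,1,2,\dots$ in which the young and the old have endowments $aG^t$ and $bG^t$, and an asset in unit supply, initially owned by the old, pays the dividend $D_t=DG_d^t$ and has price $P_t>0$. Generation $t$ chooses its asset holding $x$ to maximize $U(aG^t-P_tx,\;bG^{t+1}+(P_{t+1}+D_{t+1})x)$ over the $x$ for which both consumptions are positive. In equilibrium every generation optimizes, the initial old consume $b+P_0+D_0$, and the asset market ($x_t=1$) and the goods market clear. Let $R_t=(P_{t+1}+D_{t+1})/P_t$ and $q_t=1/\prod_{s<t}R_s$. The price contains a bubble at $t$ if $P_t>V_t:=q_t^{-1}\sum_{s>t}q_sD_s$ (with a convergent sum). Put $\xi_{1t}=P_t/G^t$ and $\xi_{2t}=(G_d/G)^t$, and define $$\Phi(\xi,\eta)=\bigl(G(\eta_1+D\eta_2)U_z-\xi_1U_y,\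 \eta_2-(G_d/G)\xi_2\bigr),$$ with $U_y,U_z$ evaluated at $(y,z)=(a-\xi_1,\,G(b+\eta_1+D\eta_2))$, for those $(\xi,\eta)\in\mathbb R^2\times\mathbb R^2$ with $y,z>0$. A path is a sequence $(\xi_t)_{t\ge 0}$ with $\xi_{1t}>0$, $\xi_{2t}=(G_d/G)^t$ and $\Phi(\xi_t,\xi_{t+1})=0$ for all $t\ge 0$. A bubbly steady state is a point $\xi^*$ with $\Phi(\xi^*,\xi^*)=0$ and $\xi_1^*>0$ (so $\xi_2^*=0$). At a bubbly steady state let $$d=G\,(U_z+G\xi_1^*U_{zz}-\xi_1^*U_{yz}),\qquad n=G\xi_1^*U_{yz}+U_y-\xi_1^*U_{yy},$$ with derivatives evaluated at $(a-\xi_1^*,\,G(b+\xi_1^*))$. Then the following statements are true. 1. There are a unique $w_f^*>0$ with $(U_y/U_z)(1,Gw_f^*)=G_d$ and a unique $w_b^*>0$ with $(U_y/U_z)(1,Gw_b^*)=G$, and $w_b^*>w_f^*$. 2. A bubbly steady state exists if and only if $b/a<w_b^*$. Moreover, a sequence $(P_t)$ is an equilibrium price sequence if and only if $(P_t/G^t,(G_d/G)^t)_{t\ge0}$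 is a path. If $b/a<w_b^*$ and $\xi^*$ is a bubbly steady state, then there exists a path converging to $\xi^*$ whenever $d\ne 0$ and $d\neq -n$, and there is exactly one such path whenever $d>0$. 3. If $b/a<w_b^*$ and $\xi^*$ is a bubbly steady state, then along every path $(\xi_t)$ converging to $\xi^*$ the sequence $P_t=\xi_{1t}G^t$ is an equilibrium price sequence, $$P_t\sim\frac{w_b^*a-b}{1+w_b^*}\,G^t\qquad(t\to\infty),$$ and the price contains a bubble at every $t$. -/

import Mathlib

open Filter Topology Asymptotics

noncomputable section

namespace OLG

/-! ### Utility function -/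

/-- First partial derivative of `U` in consumption when young. -/
def Uy (U : ℝ → ℝ → ℝ) (y z : ℝ) : ℝ := deriv (fun s => U s z) y

/-- First partial derivative of `U` in consumption when old. -/
def Uz (U : ℝ → ℝ → ℝ) (y z : ℝ) : ℝ := deriv (fun s => U y s) z

/-- Second partial derivative of `U`, twice in the first variable. -/
def Uyy (U : ℝ → ℝ → ℝ) (y z : ℝ) : ℝ := deriv (fun s => Uy U s z) y

/-- Mixed second partial derivative of `U`. -/
def Uyz (U : ℝ → ℝ → ℝ) (y z : ℝ) : ℝ := deriv (fun s => Uy U y s) z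

/-- Second partial derivative of `U`, twice in the second variable. -/
def Uzz (U : ℝ → ℝ → ℝ) (y z : ℝ) : ℝ := deriv (fun s => Uz U y s) z

/-- The standing assumption on `U : (0,∞)² → (0,∞)`. Values of `U` outside the open positive
quadrant are irrelevant. -/
structure UtilityAssumption (U : ℝ → ℝ → ℝ) : Prop where
  pos : ∀ y z : ℝ, 0 < y → 0 < z → 0 < U y z
  homogeneous : ∀ c y z : ℝ, 0 < c → 0 < y → 0 < z → U (c * y) (c * z) = c * U y z
  contDiffOn : ContDiffOn ℝ 2 (fun p : ℝ × ℝ => U p.1 p.2) {p : ℝ × ℝ | 0 < p.1 ∧ 0 < p.2}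
  Uy_pos : ∀ y z : ℝ, 0 < y → 0 < z → 0 < Uy U y z
  Uz_pos : ∀ y z : ℝ, 0 < y → 0 < z → 0 < Uz U y z
  Uyy_neg : ∀ y z : ℝ, 0 < y → 0 < z → Uyy U y z < 0
  Uzz_neg : ∀ y z : ℝ, 0 < y → 0 < z → Uzz U y z < 0
  inada_y : ∀ z : ℝ, 0 < z → Tendsto (fun y => Uy U y z) (𝓝[>] 0) atTop
  inada_z : ∀ y : ℝ, 0 < y → Tendsto (fun z => Uz U y z) (𝓝[>] 0) atTop

/-! ### Rational expectations equilibrium of the overlapping generations economy -/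

/-- `(P, x, y, z)` is an equilibrium of the economy with utility `U`, endowments `e t` of the young
and `f t` of the old, and dividends `δ t` of the single asset in unit supply. The asset is initially
owned by the old; `U` is defined for positive consumption only, so that the young choose among the
portfolios that give positive consumption at both ages. -/
structure IsEquilibrium (U : ℝ → ℝ → ℝ) (e f δ : ℕ → ℝ) (P x y z : ℕ → ℝ) : Prop where
  price_pos : ∀ t, 0 < P t
  young_pos : ∀ t, 0 < y t
  old_pos : ∀ t, 0 < z t
  budget_young : ∀ t, y t + P t * x t = e t
  budget_old : ∀ t, z (t + 1) = f (t + 1) + (P (t + 1) + δ (t + 1)) * x t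
  budget_initial_old : z 0 = f 0 + (P 0 + δ 0)
  optimal : ∀ (t : ℕ) (x' : ℝ), 0 < e t - P t * x' →
    0 < f (t + 1) + (P (t + 1) + δ (t + 1)) * x' →
    U (e t - P t * x') (f (t + 1) + (P (t + 1) + δ (t + 1)) * x') ≤ U (y t) (z (t + 1))
  asset_market : ∀ t, x t = 1
  goods_market : ∀ t, y t + z t = e t + f t + δ t

/-- `P` is an equilibrium price sequence of the economy with endowments `(a G^t, b G^t)` and
dividends `D G_d^t`. -/
def IsEquilibriumPrice (U : ℝ → ℝ → ℝ) (a b G Gd D : ℝ) (P : ℕ → ℝ) : Prop :=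
  ∃ x y z : ℕ → ℝ, IsEquilibrium U (fun t => a * G ^ t) (fun t => b * G ^ t)
    (fun t => D * Gd ^ t) P x y z

/-! ### Asset price bubbles -/

/-- Gross risk-free rate between `t` and `t + 1`. -/
def riskFreeRate (P δ : ℕ → ℝ) (t : ℕ) : ℝ := (P (t + 1) + δ (t + 1)) / P t

/-- Arrow-Debreu price: date-0 price of the good delivered at time `t`. -/
def adPrice (P δ : ℕ → ℝ) (t : ℕ) : ℝ := 1 / ∏ s ∈ Finset.range t, riskFreeRate P δ s

/-- Fundamental value at time `t`: the present value of the dividends paid after `t`. -/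
def fundamentalValue (P δ : ℕ → ℝ) (t : ℕ) : ℝ :=
  1 / adPrice P δ t * ∑' s : ℕ, adPrice P δ (t + 1 + s) * δ (t + 1 + s)

/-- At time `t` the asset price contains a bubble: the present value of the dividends is finite and
smaller than the price. -/
def HasBubbleAt (P δ : ℕ → ℝ) (t : ℕ) : Prop :=
  Summable (fun s : ℕ => adPrice P δ (t + 1 + s) * δ (t + 1 + s)) ∧
    fundamentalValue P δ t < P t

/-! ### The detrended system -/

/-- Young consumption at which the derivatives in `Phi` are evaluated. -/
def youngArg (a : ℝ) (ξ : ℝ × ℝ) : ℝ := a - ξ.1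

/-- Old consumption at which the derivatives in `Phi` are evaluated. -/
def oldArg (b G D : ℝ) (η : ℝ × ℝ) : ℝ := G * (b + η.1 + D * η.2)

/-- The map `Φ` whose zeros `Φ(ξ_t, ξ_{t+1}) = 0` are the detrended dynamics, where
`ξ_{1t} = P_t / G^t` and `ξ_{2t} = (G_d / G)^t`. -/
def Phi (U : ℝ → ℝ → ℝ) (a b G Gd D : ℝ) (ξ η : ℝ × ℝ) : ℝ × ℝ :=
  (G * (η.1 + D * η.2) * Uz U (youngArg a ξ) (oldArg b G D η)
      - ξ.1 * Uy U (youngArg a ξ) (oldArg b G D η),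
    η.2 - Gd / G * ξ.2)

/-- `Φ(ξ, η) = 0`, with `(ξ, η)` in the domain of `Φ` (both consumptions are positive). -/
def SolvesPhi (U : ℝ → ℝ → ℝ) (a b G Gd D : ℝ) (ξ η : ℝ × ℝ) : Prop :=
  0 < youngArg a ξ ∧ 0 < oldArg b G D η ∧ Phi U a b G Gd D ξ η = 0

/-- A bubbly steady state: `Φ(ξ, ξ) = 0` with positive detrended price. -/
def IsBubblySteadyState (U : ℝ → ℝ → ℝ) (a b G Gd D : ℝ) (ξ : ℝ × ℝ) : Prop :=
  SolvesPhi U a b G Gd D ξ ξ ∧ 0 < ξ.1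

/-- A path of the detrended system, with `ξ_{1t} > 0` and `ξ_{2t} = (G_d / G)^t`. -/
def IsPath (U : ℝ → ℝ → ℝ) (a b G Gd D : ℝ) (ξ : ℕ → ℝ × ℝ) : Prop :=
  ∀ t, 0 < (ξ t).1 ∧ (ξ t).2 = (Gd / G) ^ t ∧ SolvesPhi U a b G Gd D (ξ t) (ξ (t + 1))

/-- The number `d` at a steady state `ξ = (ξ₁, 0)`, with derivatives at `(a - ξ₁, G (b + ξ₁))`. -/
def dCoef (U : ℝ → ℝ → ℝ) (a b G : ℝ) (ξ : ℝ × ℝ) : ℝ :=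
  G * (Uz U (a - ξ.1) (G * (b + ξ.1)) + G * ξ.1 * Uzz U (a - ξ.1) (G * (b + ξ.1))
    - ξ.1 * Uyz U (a - ξ.1) (G * (b + ξ.1)))

/-- The number `n` at a steady state `ξ = (ξ₁, 0)`, with derivatives at `(a - ξ₁, G (b + ξ₁))`. -/
def nCoef (U : ℝ → ℝ → ℝ) (a b G : ℝ) (ξ : ℝ × ℝ) : ℝ :=
  G * ξ.1 * Uyz U (a - ξ.1) (G * (b + ξ.1)) + Uy U (a - ξ.1) (G * (b + ξ.1))
    - ξ.1 * Uyy U (a - ξ.1) (G * (b + ξ.1))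

/-- `w` is the unique positive number with `(U_y / U_z)(1, G w) = ρ`. -/
def IsUniqueThreshold (U : ℝ → ℝ → ℝ) (G ρ w : ℝ) : Prop :=
  (0 < w ∧ Uy U 1 (G * w) / Uz U 1 (G * w) = ρ) ∧
    ∀ w' : ℝ, 0 < w' → Uy U 1 (G * w') / Uz U 1 (G * w') = ρ → w' = w

end OLG

end

/-!
Homogeneity reduces every derivative of `U` to a function of the consumption ratio `w = z / y`. In
particular the marginal rate of substitution `U_y / U_z` is a function `mrs U w`, continuously
differentiable with positive derivative, and by the Inada conditions it maps `(0, ∞)` onto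
`(0, ∞)`. This gives the two thresholds. The detrended Euler equation becomes
`G η = ξ * mrs U (G (b + η) / (a - ξ))`, where `ξ` is the current price and `η` the cum-dividend
price of the next period. At a bubbly steady state it says that the ratio `(b + ξ) / (a - ξ)` equals
`wb`, so that `ξ = (wb * a - b) / (1 + wb)`. Since `U` is the perspective of a concave function, the
first-order condition is also sufficient, and equilibria are the same as paths
(`isEquilibriumPrice_iff_isPath`).

For each `η > 0` the right-hand side of the Euler equation increases in `ξ` from `0` to `∞` on `(0,
a)`, so there is a global backward map `ξ = g η` (`exists_backwardMap`), and paths are the positive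
sequences with `s t = g (s (t + 1) + u (t + 1))`, where `u t = D (Gd / G) ^ t` is the detrended
dividend. By the implicit function theorem `g` has slope `d / n` at the steady state, and `n > 0`,
`d < n` (`IsBubblySteadyState.hasStrictDerivAt_backwardMap`). As `g` is global, an orbit defined
from some date on extends back to date `0`, so only the behaviour near the steady state matters:

* if `-n < d`, then `g` is a contraction near the steady state, and a convergent orbit is the limit
  of Picard iterates (`exists_backward_orbit`); when `d > 0`, two convergent orbits agree eventually
  by contraction, hence always (`eventually_eq_of_backward_orbit`);
* if `d < -n`, then the local inverse of `g` is a contraction and is iterated forward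
  (`exists_forward_orbit`).

Along a convergent path the dividend yields `D_t / P_t` decay like `(Gd / G) ^ t`. Their
summability keeps the present value `q_t P_t` of the price away from zero, and this is the bubble
(`hasBubbleAt_of_summable`).
-/

namespace OLG

/-! ### Homogeneous utility in intensive form -/

/-- The marginal rate of substitution `U_y / U_z` at consumption ratio `w = z / y`. -/
noncomputable def mrs (U : ℝ → ℝ → ℝ) (w : ℝ) : ℝ := Uy U 1 w / Uz U 1 w

namespace UtilityAssumption

variable {U : ℝ → ℝ → ℝ}

theorem eq_mul_ratio (hU : UtilityAssumption U) {y z : ℝ} (hy : 0 < y) (hz : 0 < z) :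
    U y z = y * U 1 (z / y) := by
  have := hU.homogeneous y 1 (z / y) hy one_pos (div_pos hz hy)
  rwa [mul_one, mul_div_cancel₀ _ hy.ne'] at this

theorem contDiffOn_ratio (hU : UtilityAssumption U) : ContDiffOn ℝ 2 (fun w => U 1 w) (Set.Ioi 0) :=
  hU.contDiffOn.comp (f := fun w : ℝ => ((1 : ℝ), w)) (by fun_prop)
    fun _ hw => ⟨one_pos, hw⟩

theorem hasDerivAt_ratio (hU : UtilityAssumption U) {w : ℝ} (hw : 0 < w) :
    HasDerivAt (fun s => U 1 s) (Uz U 1 w) w :=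
  ((hU.contDiffOn_ratio.differentiableOn (by norm_num)).differentiableAt
    (Ioi_mem_nhds hw)).hasDerivAt

theorem contDiffOn_Uz_one (hU : UtilityAssumption U) :
    ContDiffOn ℝ 1 (fun w => Uz U 1 w) (Set.Ioi 0) :=
  ((contDiffOn_succ_iff_deriv_of_isOpen (n := 1) isOpen_Ioi).1
    (by simpa [one_add_one_eq_two] using hU.contDiffOn_ratio)).2.2

theorem hasDerivAt_Uz_one (hU : UtilityAssumption U) {w : ℝ} (hw : 0 < w) :
    HasDerivAt (fun s => Uz U 1 s) (Uzz U 1 w) w :=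
  ((hU.contDiffOn_Uz_one.differentiableOn (by norm_num)).differentiableAt
    (Ioi_mem_nhds hw)).hasDerivAt

theorem continuousOn_Uzz_one (hU : UtilityAssumption U) :
    ContinuousOn (fun w => Uzz U 1 w) (Set.Ioi 0) :=
  (((contDiffOn_succ_iff_deriv_of_isOpen (n := 0) isOpen_Ioi).1
    (by simpa using hU.contDiffOn_Uz_one)).2.2).continuousOn

theorem Uz_eq (hU : UtilityAssumption U) {y z : ℝ} (hy : 0 < y) (hz : 0 < z) :
    Uz U y z = Uz U 1 (z / y) := by
  have h : HasDerivAt (fun s => y * U 1 (s / y)) (y * (Uz U 1 (z / y) * (1 / y))) z :=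
    ((hU.hasDerivAt_ratio (div_pos hz hy)).comp z ((hasDerivAt_id z).div_const y)).const_mul y
  have h' := h.congr_of_eventuallyEq (f₁ := fun s => U y s)
    (by filter_upwards [Ioi_mem_nhds hz] with s hs using hU.eq_mul_ratio hy hs)
  rw [Uz, h'.deriv]
  field_simp

theorem Uy_eq (hU : UtilityAssumption U) {y z : ℝ} (hy : 0 < y) (hz : 0 < z) :
    Uy U y z = U 1 (z / y) - z / y * Uz U 1 (z / y) := by
  have h : HasDerivAt (fun s => s * U 1 (z / s))
      (1 * U 1 (z / y) + y * (Uz U 1 (z / y) * ((0 * y - z * 1) / y ^ 2))) y :=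
    (hasDerivAt_id y).mul ((hU.hasDerivAt_ratio (div_pos hz hy)).comp y
      ((hasDerivAt_const y z).div (hasDerivAt_id y) hy.ne'))
  have h' := h.congr_of_eventuallyEq (f₁ := fun s => U s z)
    (by filter_upwards [Ioi_mem_nhds hy] with s hs using hU.eq_mul_ratio hs hz)
  rw [Uy, h'.deriv]
  field_simp
  ring

theorem Uy_eq_one (hU : UtilityAssumption U) {y z : ℝ} (hy : 0 < y) (hz : 0 < z) :
    Uy U y z = Uy U 1 (z / y) := by
  rw [hU.Uy_eq hy hz, hU.Uy_eq one_pos (div_pos hz hy), div_one]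

theorem Uy_eq_mrs_mul (hU : UtilityAssumption U) {y z : ℝ} (hy : 0 < y) (hz : 0 < z) :
    Uy U y z = mrs U (z / y) * Uz U y z := by
  rw [hU.Uy_eq_one hy hz, hU.Uz_eq hy hz, mrs,
    div_mul_cancel₀ _ (hU.Uz_pos 1 _ one_pos (div_pos hz hy)).ne']

theorem Uzz_eq (hU : UtilityAssumption U) {y z : ℝ} (hy : 0 < y) (hz : 0 < z) :
    Uzz U y z = Uzz U 1 (z / y) / y := by
  have h : HasDerivAt (fun s => Uz U 1 (s / y)) (Uzz U 1 (z / y) * (1 / y)) z :=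
    (hU.hasDerivAt_Uz_one (div_pos hz hy)).comp z ((hasDerivAt_id z).div_const y)
  have h' := h.congr_of_eventuallyEq (f₁ := fun s => Uz U y s)
    (by filter_upwards [Ioi_mem_nhds hz] with s hs using hU.Uz_eq hy hs)
  rw [Uzz, h'.deriv, mul_one_div]

/-- The derivative of `U_y(1, ·)`, from Euler's identity `U = U_y + w U_z`. -/
theorem hasDerivAt_Uy_ratio (hU : UtilityAssumption U) {w : ℝ} (hw : 0 < w) :
    HasDerivAt (fun s => U 1 s - s * Uz U 1 s) (-(w * Uzz U 1 w)) w := by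
  have h := (hU.hasDerivAt_ratio hw).sub ((hasDerivAt_id w).mul (hU.hasDerivAt_Uz_one hw))
  refine h.congr_deriv ?_
  simp

theorem Uyz_eq (hU : UtilityAssumption U) {y z : ℝ} (hy : 0 < y) (hz : 0 < z) :
    Uyz U y z = -(z / y * Uzz U 1 (z / y)) / y := by
  have h : HasDerivAt (fun s => U 1 (s / y) - s / y * Uz U 1 (s / y))
      (-(z / y * Uzz U 1 (z / y)) * (1 / y)) z :=
    HasDerivAt.comp (h₂ := fun s => U 1 s - s * Uz U 1 s) (h := fun s => s / y) z
      (hU.hasDerivAt_Uy_ratio (div_pos hz hy)) ((hasDerivAt_id z).div_const y)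
  have h' := h.congr_of_eventuallyEq (f₁ := fun s => Uy U y s)
    (by filter_upwards [Ioi_mem_nhds hz] with s hs using hU.Uy_eq hy hs)
  rw [Uyz, h'.deriv, mul_one_div]

theorem Uyy_eq (hU : UtilityAssumption U) {y z : ℝ} (hy : 0 < y) (hz : 0 < z) :
    Uyy U y z = (z / y) ^ 2 * Uzz U 1 (z / y) / y := by
  have h : HasDerivAt (fun s => U 1 (z / s) - z / s * Uz U 1 (z / s))
      (-(z / y * Uzz U 1 (z / y)) * ((0 * y - z * 1) / y ^ 2)) y :=
    (hU.hasDerivAt_Uy_ratio (div_pos hz hy)).comp y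
      ((hasDerivAt_const y z).div (hasDerivAt_id y) hy.ne')
  have h' := h.congr_of_eventuallyEq (f₁ := fun s => Uy U s z)
    (by filter_upwards [Ioi_mem_nhds hy] with s hs using hU.Uy_eq hs hz)
  rw [Uyy, h'.deriv]
  field_simp
  ring

theorem mrs_pos (hU : UtilityAssumption U) {w : ℝ} (hw : 0 < w) : 0 < mrs U w :=
  div_pos (hU.Uy_pos 1 w one_pos hw) (hU.Uz_pos 1 w one_pos hw)

theorem hasDerivAt_mrs (hU : UtilityAssumption U) {w : ℝ} (hw : 0 < w) :
    HasDerivAt (mrs U) (-(U 1 w * Uzz U 1 w) / Uz U 1 w ^ 2) w := by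
  have hz := hU.Uz_pos 1 w one_pos hw
  have h := (hU.hasDerivAt_Uy_ratio hw).div (hU.hasDerivAt_Uz_one hw) hz.ne'
  have h' := h.congr_of_eventuallyEq (f₁ := mrs U) (by
    filter_upwards [Ioi_mem_nhds hw] with s hs
    simp [mrs, hU.Uy_eq one_pos hs])
  refine h'.congr_deriv ?_
  field_simp
  ring

theorem hasStrictDerivAt_mrs (hU : UtilityAssumption U) {w : ℝ} (hw : 0 < w) :
    HasStrictDerivAt (mrs U) (-(U 1 w * Uzz U 1 w) / Uz U 1 w ^ 2) w := by
  refine hasStrictDerivAt_of_hasDerivAt_of_continuousAt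
    (f' := fun w => -(U 1 w * Uzz U 1 w) / Uz U 1 w ^ 2) ?_ ?_
  · filter_upwards [Ioi_mem_nhds hw] with s hs using hU.hasDerivAt_mrs hs
  · exact (((hU.hasDerivAt_ratio hw).continuousAt.mul
      (hU.continuousOn_Uzz_one.continuousAt (Ioi_mem_nhds hw))).neg).div
      ((hU.hasDerivAt_Uz_one hw).continuousAt.pow 2)
      (pow_ne_zero _ (hU.Uz_pos 1 w one_pos hw).ne')

theorem deriv_mrs_pos (hU : UtilityAssumption U) {w : ℝ} (hw : 0 < w) : 0 < deriv (mrs U) w := by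
  rw [(hU.hasDerivAt_mrs hw).deriv]
  have h1 := hU.pos 1 w one_pos hw
  have h2 := hU.Uzz_neg 1 w one_pos hw
  exact div_pos (by nlinarith) (pow_pos (hU.Uz_pos 1 w one_pos hw) 2)

theorem continuousOn_mrs (hU : UtilityAssumption U) : ContinuousOn (mrs U) (Set.Ioi 0) :=
  fun _ hw => (hU.hasDerivAt_mrs hw).continuousAt.continuousWithinAt

theorem strictMonoOn_mrs (hU : UtilityAssumption U) : StrictMonoOn (mrs U) (Set.Ioi 0) := by
  refine strictMonoOn_of_deriv_pos (convex_Ioi 0) hU.continuousOn_mrs fun w hw => ?_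
  rw [interior_Ioi] at hw
  exact hU.deriv_mrs_pos hw

theorem antitoneOn_Uz_one (hU : UtilityAssumption U) :
    AntitoneOn (fun w => Uz U 1 w) (Set.Ioi 0) := by
  refine antitoneOn_of_deriv_nonpos (convex_Ioi 0) hU.contDiffOn_Uz_one.continuousOn ?_ ?_
  · rw [interior_Ioi]
    exact hU.contDiffOn_Uz_one.differentiableOn (by norm_num)
  · intro w hw
    rw [interior_Ioi] at hw
    exact (hU.Uzz_neg 1 w one_pos hw).le

theorem monotoneOn_Uy_one (hU : UtilityAssumption U) :
    MonotoneOn (fun w => Uy U 1 w) (Set.Ioi 0) := by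
  have hd : ∀ w : ℝ, 0 < w → HasDerivAt (fun w => Uy U 1 w) (-(w * Uzz U 1 w)) w := fun w hw =>
    (hU.hasDerivAt_Uy_ratio hw).congr_of_eventuallyEq (by
      filter_upwards [Ioi_mem_nhds hw] with s hs
      simp [hU.Uy_eq one_pos hs])
  refine monotoneOn_of_deriv_nonneg (convex_Ioi 0)
    (fun w hw => (hd w hw).continuousAt.continuousWithinAt) ?_ ?_
  · rw [interior_Ioi]
    exact fun w hw => (hd w hw).differentiableAt.differentiableWithinAt
  · intro w hw
    rw [interior_Ioi] at hw
    rw [(hd w hw).deriv]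
    have := hU.Uzz_neg 1 w one_pos hw
    have hw' : 0 < w := hw
    nlinarith

/-- Since `U_y(1, w) = U_y(1 / w, 1)`, the Inada condition at zero consumption when young makes
the marginal rate of substitution unbounded. -/
theorem exists_lt_mrs (hU : UtilityAssumption U) (c : ℝ) : ∃ w, 0 < w ∧ c < mrs U w := by
  have hz := hU.Uz_pos 1 1 one_pos one_pos
  obtain ⟨y, hcy, hy0, hy1⟩ := (((hU.inada_y 1 one_pos).eventually_gt_atTop
    (|c| * Uz U 1 1)).and (Ioo_mem_nhdsGT one_pos)).exists
  have hw : 0 < 1 / y := one_div_pos.2 hy0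
  refine ⟨1 / y, hw, (le_abs_self c).trans_lt ?_⟩
  rw [mrs, lt_div_iff₀ (hU.Uz_pos 1 _ one_pos hw), ← hU.Uy_eq_one hy0 one_pos]
  refine lt_of_le_of_lt (mul_le_mul_of_nonneg_left ?_ (abs_nonneg c)) hcy
  exact hU.antitoneOn_Uz_one (Set.mem_Ioi.2 one_pos) hw (one_le_one_div hy0 hy1.le)

theorem exists_mrs_lt (hU : UtilityAssumption U) {c : ℝ} (hc : 0 < c) :
    ∃ w, 0 < w ∧ mrs U w < c := by
  obtain ⟨w, hcw, hw0, hw1⟩ := (((hU.inada_z 1 one_pos).eventually_gt_atTop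
    (Uy U 1 1 / c)).and (Ioo_mem_nhdsGT one_pos)).exists
  refine ⟨w, hw0, ?_⟩
  rw [div_lt_iff₀ hc] at hcw
  rw [mrs, div_lt_iff₀ (hU.Uz_pos 1 _ one_pos hw0), mul_comm]
  exact (hU.monotoneOn_Uy_one hw0 (Set.mem_Ioi.2 one_pos) hw1.le).trans_lt hcw

theorem exists_mrs_eq (hU : UtilityAssumption U) {c : ℝ} (hc : 0 < c) :
    ∃ w, 0 < w ∧ mrs U w = c := by
  obtain ⟨w₁, h₁, hc₁⟩ := hU.exists_mrs_lt hc
  obtain ⟨w₂, h₂, hc₂⟩ := hU.exists_lt_mrs c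
  obtain ⟨w, hw, h⟩ := isPreconnected_Ioi.intermediate_value (Set.mem_Ioi.2 h₁)
    (Set.mem_Ioi.2 h₂) hU.continuousOn_mrs ⟨hc₁.le, hc₂.le⟩
  exact ⟨w, hw, h⟩

theorem exists_isUniqueThreshold (hU : UtilityAssumption U) {G ρ : ℝ} (hG : 0 < G) (hρ : 0 < ρ) :
    ∃ w, IsUniqueThreshold U G ρ w := by
  obtain ⟨w, hw, h⟩ := hU.exists_mrs_eq hρ
  refine ⟨w / G, ⟨div_pos hw hG, ?_⟩, fun w' hw' h' => ?_⟩
  · rw [mul_div_cancel₀ _ hG.ne']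
    exact h
  · have := hU.strictMonoOn_mrs.injOn (Set.mem_Ioi.2 (mul_pos hG hw')) hw (h'.trans h.symm)
    rw [← this, mul_div_cancel_left₀ _ hG.ne']

/-- Euler's identity for homogeneous functions of degree one. -/
theorem euler (hU : UtilityAssumption U) {y z : ℝ} (hy : 0 < y) (hz : 0 < z) :
    U y z = Uy U y z * y + Uz U y z * z := by
  rw [hU.eq_mul_ratio hy hz, hU.Uy_eq hy hz, hU.Uz_eq hy hz]
  field_simp
  ring

theorem ratio_le_tangent (hU : UtilityAssumption U) {v w : ℝ} (hv : 0 < v) (hw : 0 < w) :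
    U 1 v ≤ U 1 w + Uz U 1 w * (v - w) := by
  have hanti := hU.antitoneOn_Uz_one
  have hconc : ConcaveOn ℝ (Set.Ioi 0) (fun s => U 1 s) := by
    refine AntitoneOn.concaveOn_of_deriv (convex_Ioi 0) hU.contDiffOn_ratio.continuousOn ?_ ?_
    · rw [interior_Ioi]
      exact hU.contDiffOn_ratio.differentiableOn (by norm_num)
    · rw [interior_Ioi]
      exact hanti
  rcases lt_trichotomy v w with h | rfl | h
  · have := hconc.le_slope_of_hasDerivAt hv hw h (hU.hasDerivAt_ratio hw)
    rw [slope_def_field, le_div_iff₀ (by linarith)] at this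
    linarith
  · simp
  · have := hconc.slope_le_of_hasDerivAt hw hv h (hU.hasDerivAt_ratio hw)
    rw [slope_def_field, div_le_iff₀ (by linarith)] at this
    linarith

/-- Supergradient inequality: `U` is the perspective of the concave function `U(1, ·)`. -/
theorem le_supergradient (hU : UtilityAssumption U) {y z y' z' : ℝ} (hy : 0 < y)
    (hz : 0 < z) (hy' : 0 < y') (hz' : 0 < z') :
    U y' z' ≤ Uy U y z * y' + Uz U y z * z' := by
  rw [hU.eq_mul_ratio hy' hz', hU.Uy_eq hy hz, hU.Uz_eq hy hz]
  have := mul_le_mul_of_nonneg_left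
    (hU.ratio_le_tangent (div_pos hz' hy') (div_pos hz hy)) hy'.le
  refine this.trans_eq ?_
  field_simp
  ring

end UtilityAssumption

/-! ### Perturbed contractions on the line -/

/-- If `g` contracts a ball around its fixed point `x`, the backward recursion
`s t = g (s (t + 1) + u (t + 1))` with a small decreasing perturbation `u` has a solution within
a multiple of `u t` of `x`. It is the limit of the Picard iterates started at the constant `x`. -/
theorem exists_backward_orbit {g : ℝ → ℝ} {x k δ : ℝ} {u : ℕ → ℝ} (hk0 : 0 ≤ k) (hk1 : k < 1)
    (hgx : g x = x) (hg : ∀ p q, |p - x| ≤ δ → |q - x| ≤ δ → |g p - g q| ≤ k * |p - q|)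
    (hu0 : ∀ t, 0 ≤ u t) (hu : Antitone u) (huδ : u 0 / (1 - k) ≤ δ) :
    ∃ s : ℕ → ℝ, ∀ t, s t = g (s (t + 1) + u (t + 1)) ∧ |s t - x| ≤ k / (1 - k) * u t := by
  have hk : 0 < 1 - k := by linarith
  -- `C = k / (1 - k)` is the fixed point of `C ↦ k (C + 1)`.
  set C := k / (1 - k) with hC
  have hC0 : 0 ≤ C := div_nonneg hk0 hk.le
  have hC1 : k * (C + 1) = C := by rw [hC]; field_simp; ring
  have hCδ : ∀ t, (C + 1) * u t ≤ δ := fun t => by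
    have h1 : C + 1 = 1 / (1 - k) := by rw [hC]; field_simp; ring
    have := hu (Nat.zero_le t)
    refine le_trans ?_ huδ
    rw [h1, one_div, inv_mul_eq_div]
    gcongr
  have hball : ∀ t p, |p - x| ≤ C * u (t + 1) → |p + u (t + 1) - x| ≤ δ := fun t p hp => by
    have : |p + u (t + 1) - x| ≤ |p - x| + |u (t + 1)| := by
      rw [add_sub_right_comm]; exact abs_add_le _ _
    rw [abs_of_nonneg (hu0 _)] at this
    linarith [hCδ (t + 1)]
  have hδ : 0 ≤ δ := (div_nonneg (hu0 0) hk.le).trans huδ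
  have hxx : |x - x| ≤ δ := by simpa using hδ
  have hstep : ∀ t p, |p - x| ≤ C * u (t + 1) → |g (p + u (t + 1)) - x| ≤ C * u t := by
    intro t p hp
    have h1 := hg _ _ (hball t p hp) hxx
    rw [hgx] at h1
    have h2 : |p + u (t + 1) - x| ≤ |p - x| + |u (t + 1)| := by
      rw [add_sub_right_comm]; exact abs_add_le _ _
    rw [abs_of_nonneg (hu0 _)] at h2
    have h3 := hu (Nat.le_succ t)
    calc |g (p + u (t + 1)) - x| ≤ k * ((C + 1) * u (t + 1)) :=
          h1.trans (mul_le_mul_of_nonneg_left (by linarith) hk0)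
      _ = C * u (t + 1) := by rw [← mul_assoc, hC1]
      _ ≤ C * u t := mul_le_mul_of_nonneg_left h3 hC0
  let S : ℕ → ℕ → ℝ := fun n => Nat.rec (fun _ => x) (fun _ s t => g (s (t + 1) + u (t + 1))) n
  have hS : ∀ n t, |S n t - x| ≤ C * u t := by
    intro n
    induction n with
    | zero => intro t; simpa [S] using mul_nonneg hC0 (hu0 t)
    | succ n ih => intro t; exact hstep t _ (ih (t + 1))
  have hcauchy : ∀ n t, |S (n + 1) t - S n t| ≤ δ * k ^ n := by
    intro n
    induction n with
    | zero =>
      intro t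
      have h := hS 1 t
      have : S 0 t = x := rfl
      rw [this, zero_add, pow_zero, mul_one]
      nlinarith [hCδ t, hu0 t]
    | succ n ih =>
      intro t
      have h := hg _ _ (hball t _ (hS (n + 1) (t + 1))) (hball t _ (hS n (t + 1)))
      rw [add_sub_add_right_eq_sub] at h
      refine h.trans ((mul_le_mul_of_nonneg_left (ih (t + 1)) hk0).trans_eq ?_)
      ring
  have hlim : ∀ t, ∃ l, Tendsto (fun n => S n t) atTop (𝓝 l) := fun t =>
    cauchySeq_tendsto_of_complete (cauchySeq_of_le_geometric k δ hk1 fun n => by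
      rw [dist_comm, Real.dist_eq]; exact hcauchy n t)
  choose s hs using hlim
  have hsb : ∀ t, |s t - x| ≤ C * u t := fun t =>
    le_of_tendsto ((hs t).sub_const x).abs (Eventually.of_forall fun n => hS n t)
  refine ⟨s, fun t => ⟨?_, hsb t⟩⟩
  refine tendsto_nhds_unique ((tendsto_add_atTop_iff_nat 1).2 (hs t)) ?_
  rw [tendsto_iff_dist_tendsto_zero]
  have h0 : Tendsto (fun n => k * |S n (t + 1) - s (t + 1)|) atTop (𝓝 0) := by
    simpa using (((hs (t + 1)).sub_const (s (t + 1))).abs).const_mul k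
  refine squeeze_zero (fun _ => dist_nonneg) (fun n => ?_) h0
  have h := hg _ _ (hball t _ (hS n (t + 1))) (hball t _ (hsb (t + 1)))
  rwa [add_sub_add_right_eq_sub] at h

/-- Two solutions of the backward recursion that converge to a point near which `g` is a
contraction eventually coincide: their distance grows geometrically forward in time. -/
theorem eventually_eq_of_backward_orbit {g : ℝ → ℝ} {x k δ : ℝ} {u s s' : ℕ → ℝ} (hk0 : 0 ≤ k)
    (hk1 : k < 1) (hδ : 0 < δ)
    (hg : ∀ p q, |p - x| ≤ δ → |q - x| ≤ δ → |g p - g q| ≤ k * |p - q|)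
    (hu : Tendsto u atTop (𝓝 0)) (hs : Tendsto s atTop (𝓝 x)) (hs' : Tendsto s' atTop (𝓝 x))
    (h : ∀ t, s t = g (s (t + 1) + u (t + 1))) (h' : ∀ t, s' t = g (s' (t + 1) + u (t + 1))) :
    ∀ᶠ t in atTop, s t = s' t := by
  have key : ∀ v : ℕ → ℝ, Tendsto v atTop (𝓝 x) →
      ∀ᶠ t in atTop, |v (t + 1) + u (t + 1) - x| ≤ δ := fun v hv => by
    have h1 : Tendsto (fun t => |v (t + 1) + u (t + 1) - x|) atTop (𝓝 0) := by
      have := (((hv.add hu).sub_const x).abs).comp (tendsto_add_atTop_nat 1)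
      simpa [Function.comp_def] using this
    exact (h1.eventually_lt_const hδ).mono fun _ => le_of_lt
  obtain ⟨T, hT⟩ := eventually_atTop.1 ((key s hs).and (key s' hs'))
  have hstep : ∀ t ≥ T, |s t - s' t| ≤ k * |s (t + 1) - s' (t + 1)| := fun t ht => by
    have := hg _ _ (hT t ht).1 (hT t ht).2
    rwa [add_sub_add_right_eq_sub, ← h, ← h'] at this
  filter_upwards [eventually_ge_atTop T] with t ht
  have hpow : ∀ m, |s t - s' t| ≤ k ^ m * |s (t + m) - s' (t + m)| := by
    intro m
    induction m with
    | zero => simp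
    | succ m ih =>
      refine ih.trans ((mul_le_mul_of_nonneg_left (hstep (t + m) (by omega))
        (pow_nonneg hk0 m)).trans_eq ?_)
      rw [pow_succ, mul_assoc, add_assoc]
  have hdiff : Tendsto (fun m => |s (t + m) - s' (t + m)|) atTop (𝓝 0) := by
    have := ((hs.sub hs').abs).comp (tendsto_add_atTop_nat t)
    simpa [Function.comp_def, add_comm] using this
  have h0 : Tendsto (fun m => k ^ m * |s (t + m) - s' (t + m)|) atTop (𝓝 0) := by
    simpa using (tendsto_pow_atTop_nhds_zero_of_lt_one hk0 hk1).mul hdiff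
  exact sub_eq_zero.1 (abs_nonpos_iff.1 (ge_of_tendsto' h0 hpow))

/-- If `h` contracts a ball towards its centre `x`, the forward recursion
`s (t + 1) = h (s t) - u (t + 1)` started at `x` stays in the ball and converges to `x`, for a
small perturbation `u` decaying geometrically at a rate `r < k`. -/
theorem exists_forward_orbit {h : ℝ → ℝ} {x k δ r : ℝ} {u : ℕ → ℝ} (hr : 0 ≤ r) (hrk : r < k)
    (hk1 : k < 1) (hh : ∀ p, |p - x| ≤ δ → |h p - x| ≤ k * |p - x|)
    (hu0 : ∀ t, 0 ≤ u t) (hur : ∀ t, u (t + 1) = r * u t) (huδ : u 0 ≤ (1 - k) * δ) :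
    ∃ s : ℕ → ℝ, (∀ t, s (t + 1) + u (t + 1) = h (s t)) ∧ (∀ t, |s t - x| ≤ δ) ∧
      Tendsto s atTop (𝓝 x) := by
  have hk0 : 0 ≤ k := hr.trans hrk.le
  have hδ : 0 ≤ δ := by
    by_contra! hneg
    nlinarith [hu0 0]
  have huδ' : ∀ t, u t ≤ (1 - k) * δ := by
    intro t
    induction t with
    | zero => exact huδ
    | succ t ih => rw [hur]; nlinarith [hu0 t]
  let s : ℕ → ℝ := fun n => Nat.rec x (fun t p => h p - u (t + 1)) n
  have hs : ∀ t, s (t + 1) = h (s t) - u (t + 1) := fun _ => rfl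
  have hbound : ∀ t, |s t - x| ≤ δ → |s (t + 1) - x| ≤ k * |s t - x| + u (t + 1) := fun t ht => by
    have : |s (t + 1) - x| ≤ |h (s t) - x| + |u (t + 1)| := by
      rw [hs, sub_right_comm]; exact abs_sub _ _
    rw [abs_of_nonneg (hu0 _)] at this
    linarith [hh _ ht]
  have hball : ∀ t, |s t - x| ≤ δ := by
    intro t
    induction t with
    | zero => simpa [s] using hδ
    | succ t ih =>
      have := mul_le_mul_of_nonneg_left ih hk0
      linarith [hbound t ih, huδ' (t + 1)]
  refine ⟨s, fun t => by rw [hs]; ring, hball, ?_⟩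
  -- With `N = r / (k - r)` the quantity `|s t - x| + N * u t` shrinks by the factor `k`.
  set N := r / (k - r) with hN
  have hkr : 0 < k - r := sub_pos.2 hrk
  have hN0 : 0 ≤ N := div_nonneg hr hkr.le
  have hN1 : (1 + N) * r = k * N := by rw [hN]; field_simp; ring
  have hgeo : ∀ t, |s t - x| + N * u t ≤ k ^ t * (N * u 0) := by
    intro t
    induction t with
    | zero => simp [s]
    | succ t ih =>
      calc |s (t + 1) - x| + N * u (t + 1) ≤ k * |s t - x| + (1 + N) * r * u t := by
            have := hbound t (hball t)
            rw [hur] at this ⊢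
            linarith
        _ = k * (|s t - x| + N * u t) := by rw [hN1]; ring
        _ ≤ k * (k ^ t * (N * u 0)) := mul_le_mul_of_nonneg_left ih hk0
        _ = k ^ (t + 1) * (N * u 0) := by ring
  rw [tendsto_iff_dist_tendsto_zero]
  have h0 : Tendsto (fun t => k ^ t * (N * u 0)) atTop (𝓝 0) := by
    simpa using (tendsto_pow_atTop_nhds_zero_of_lt_one hk0 hk1).mul_const (N * u 0)
  refine squeeze_zero (fun _ => dist_nonneg) (fun t => ?_) h0
  rw [Real.dist_eq]
  nlinarith [hgeo t, hu0 t]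

/-- A positive solution of the backward recursion from date `T` on extends to all earlier dates
when `g` preserves positivity. -/
theorem exists_extend_backward {g : ℝ → ℝ} {u : ℕ → ℝ} (hg : ∀ p, 0 < p → 0 < g p)
    (hu : ∀ t, 0 ≤ u t) (T : ℕ) : ∀ s' : ℕ → ℝ, (∀ t, 0 < s' t) →
      (∀ t, s' t = g (s' (t + 1) + u (T + t + 1))) →
      ∃ s : ℕ → ℝ, (∀ t, 0 < s t) ∧ (∀ t, s t = g (s (t + 1) + u (t + 1))) ∧
        ∀ t, s (T + t) = s' t := by
  induction T with
  | zero => exact fun s' h1 h2 => ⟨s', h1, by simpa using h2, by simp⟩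
  | succ T ih =>
    intro s' h1 h2
    obtain ⟨s, hs1, hs2, hs3⟩ :=
      ih (fun t => Nat.casesOn t (g (s' 0 + u (T + 1))) s')
        (fun t => by
          cases t with
          | zero => exact hg _ (add_pos_of_pos_of_nonneg (h1 0) (hu _))
          | succ t => exact h1 t)
        (fun t => by
          cases t with
          | zero => rfl
          | succ t => simpa [add_right_comm, add_assoc] using h2 t)
    exact ⟨s, hs1, hs2, fun t => by simpa [add_right_comm, add_assoc] using hs3 (t + 1)⟩

/-- A function with a strict derivative smaller than `k` in absolute value is `k`-Lipschitz on a
small ball. -/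
theorem exists_abs_sub_le_of_hasStrictDerivAt {g : ℝ → ℝ} {x g' k : ℝ}
    (hg : HasStrictDerivAt g g' x) (hk : |g'| < k) :
    ∀ᶠ δ in 𝓝[>] (0 : ℝ),
      ∀ p q, |p - x| ≤ δ → |q - x| ≤ δ → |g p - g q| ≤ k * |p - q| := by
  lift k to NNReal using (abs_nonneg g').trans hk.le
  obtain ⟨s, hs, hlip⟩ := hg.hasStrictFDerivAt.exists_lipschitzOnWith_of_nnnorm_lt k (by
    rw [← NNReal.coe_lt_coe]
    simpa using hk)
  obtain ⟨ε, hε, hball⟩ := Metric.mem_nhds_iff.1 hs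
  filter_upwards [Ioo_mem_nhdsGT hε] with δ hδ p q hp hq
  have hp' : p ∈ s := hball (by rw [Metric.mem_ball, Real.dist_eq]; exact hp.trans_lt hδ.2)
  have hq' : q ∈ s := hball (by rw [Metric.mem_ball, Real.dist_eq]; exact hq.trans_lt hδ.2)
  simpa [Real.dist_eq] using hlip.dist_le_mul p hp' q hq'

/-- The implicit function theorem in the plane, with the slope of the implicit function. -/
theorem exists_implicit_of_hasStrictFDerivAt {F : ℝ × ℝ → ℝ} {v : ℝ × ℝ} {p q : ℝ}
    (hF : HasStrictFDerivAt F
      (p • ContinuousLinearMap.fst ℝ ℝ ℝ + q • ContinuousLinearMap.snd ℝ ℝ ℝ) v) (hq : q ≠ 0) :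
    ∃ ψ : ℝ → ℝ, HasStrictDerivAt ψ (-p / q) v.1 ∧ ψ v.1 = v.2 ∧
      ∀ᶠ x in 𝓝 v.1, F (x, ψ x) = F v := by
  set L := p • ContinuousLinearMap.fst ℝ ℝ ℝ + q • ContinuousLinearMap.snd ℝ ℝ ℝ with hL
  have hinr : ((ContinuousLinearEquiv.unitsEquivAut ℝ (Units.mk0 q hq) : ℝ ≃L[ℝ] ℝ) : ℝ →L[ℝ] ℝ) =
      L ∘L .inr ℝ ℝ ℝ := by
    ext; simp [hL]
  have hinv : (L ∘L .inr ℝ ℝ ℝ).IsInvertible := ⟨_, hinr⟩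
  refine ⟨hF.implicitFunctionOfProdDomain hinv, ?_, ?_,
    hF.eventually_apply_implicitFunctionOfProdDomain hinv⟩
  · have h := (hF.hasStrictFDerivAt_implicitFunctionOfProdDomain hinv).hasStrictDerivAt
    refine h.congr_deriv ?_
    rw [← hinr, ContinuousLinearMap.inverse_equiv]
    simp [hL, div_eq_mul_inv]
  · exact (hF.eventually_apply_eq_iff_implicitFunctionOfProdDomain hinv).self_of_nhds.1 rfl

/-! ### The detrended Euler equation and its backward map -/

/-- Residual of the detrended Euler equation, as a function of the pair `(η, ξ)` of the cum-dividend
price `η` of the next period and the current price `ξ`. -/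
noncomputable def eulerResidual (U : ℝ → ℝ → ℝ) (a b G : ℝ) (v : ℝ × ℝ) : ℝ :=
  G * v.1 - v.2 * mrs U (G * (b + v.1) / (a - v.2))

section

variable {U : ℝ → ℝ → ℝ} {a b G : ℝ}

/-- The zeros of `Φ` depend on the next period only through the cum-dividend price. -/
theorem solvesPhi_iff (hU : UtilityAssumption U) (hb : 0 ≤ b) (hG : 0 < G) {Gd D : ℝ}
    {ξ η : ℝ × ℝ} (hη : 0 < η.1 + D * η.2) :
    SolvesPhi U a b G Gd D ξ η ↔
      ξ.1 < a ∧ eulerResidual U a b G (η.1 + D * η.2, ξ.1) = 0 ∧ η.2 = Gd / G * ξ.2 := by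
  have hz : 0 < oldArg b G D η := mul_pos hG (by linarith)
  have hz' : oldArg b G D η = G * (b + (η.1 + D * η.2)) := by rw [oldArg, add_assoc]
  rw [SolvesPhi, Phi, Prod.mk_eq_zero, sub_eq_zero (b := Gd / G * ξ.2)]
  refine ⟨fun ⟨hy, _, h1, h2⟩ => ⟨sub_pos.1 hy, ?_, h2⟩,
    fun ⟨hy, h1, h2⟩ => ⟨sub_pos.2 hy, hz, ?_, h2⟩⟩
  · rw [hU.Uy_eq_mrs_mul hy hz, ← mul_assoc, ← sub_mul] at h1
    have := (mul_eq_zero.1 h1).resolve_right (hU.Uz_pos _ _ hy hz).ne'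
    rwa [hz'] at this
  · have hy' : 0 < youngArg a ξ := sub_pos.2 hy
    rw [hU.Uy_eq_mrs_mul hy' hz, ← mul_assoc, ← sub_mul, hz']
    exact mul_eq_zero_of_left h1 _

theorem strictAntiOn_eulerResidual (hU : UtilityAssumption U) (hb : 0 ≤ b) (hG : 0 < G) {η : ℝ}
    (hη : 0 < η) : StrictAntiOn (fun ξ => eulerResidual U a b G (η, ξ)) (Set.Ioo 0 a) := by
  rintro ξ ⟨h0, ha⟩ ξ' ⟨h0', ha'⟩ h
  have hc : 0 < G * (b + η) := mul_pos hG (by linarith)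
  have hy : 0 < a - ξ := sub_pos.2 ha
  have hy' : 0 < a - ξ' := sub_pos.2 ha'
  have hm := hU.strictMonoOn_mrs (Set.mem_Ioi.2 (div_pos hc hy)) (Set.mem_Ioi.2 (div_pos hc hy'))
    (div_lt_div_of_pos_left hc hy' (by linarith))
  have hp := hU.mrs_pos (div_pos hc hy)
  simp only [eulerResidual]
  nlinarith [mul_pos h0' (sub_pos.2 hm), mul_pos (sub_pos.2 h) hp]

theorem exists_eulerResidual_eq_zero (hU : UtilityAssumption U) (ha : 0 < a) (hb : 0 ≤ b)
    (hG : 0 < G) {η : ℝ} (hη : 0 < η) :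
    ∃ ξ, 0 < ξ ∧ ξ < a ∧ eulerResidual U a b G (η, ξ) = 0 := by
  set c := G * (b + η) with hc
  have hc0 : 0 < c := mul_pos hG (by linarith)
  obtain ⟨W, hW0, hW⟩ := hU.exists_lt_mrs (2 * (G * η) / a)
  -- From `ξ₁` on, the consumption ratio is at least `W` and the price at least `a / 2`.
  set ξ₁ := max (a / 2) (a - c / W) with hξ₁
  have h2 : a / 2 ≤ ξ₁ := le_max_left _ _
  have hlt : ξ₁ < a := max_lt (by linarith) (by have := div_pos hc0 hW0; linarith)
  have hy : 0 < a - ξ₁ := sub_pos.2 hlt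
  have hWle : W ≤ c / (a - ξ₁) := by
    have h3 : a - c / W ≤ ξ₁ := le_max_right _ _
    rw [le_div_iff₀ hy, mul_comm, ← le_div_iff₀ hW0]
    linarith
  have hm := hW.trans_le (hU.strictMonoOn_mrs.monotoneOn (Set.mem_Ioi.2 hW0)
    (Set.mem_Ioi.2 (div_pos hc0 hy)) hWle)
  have hneg : eulerResidual U a b G (η, ξ₁) < 0 := by
    rw [div_lt_iff₀ ha] at hm
    have hmp := hU.mrs_pos (div_pos hc0 hy)
    simp only [eulerResidual, ← hc]
    nlinarith
  have hcont : ContinuousOn (fun ξ => eulerResidual U a b G (η, ξ)) (Set.Icc 0 ξ₁) := by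
    have hratio : ContinuousOn (fun ξ => c / (a - ξ)) (Set.Icc 0 ξ₁) :=
      continuousOn_const.div (by fun_prop) fun ξ hξ => (by linarith [hξ.2] : 0 < a - ξ).ne'
    have hmrs : ContinuousOn (fun ξ => mrs U (c / (a - ξ))) (Set.Icc 0 ξ₁) :=
      hU.continuousOn_mrs.comp hratio fun ξ hξ => div_pos hc0 (by linarith [hξ.2] : 0 < a - ξ)
    simp only [eulerResidual, ← hc]
    fun_prop
  have hpos : 0 < eulerResidual U a b G (η, 0) := by simpa [eulerResidual] using mul_pos hG hη
  obtain ⟨ξ, hξ, h⟩ := intermediate_value_Icc' (by linarith) hcont ⟨hneg.le, hpos.le⟩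
  refine ⟨ξ, lt_of_le_of_ne hξ.1 ?_, hξ.2.trans_lt hlt, h⟩
  rintro rfl
  exact hpos.ne' h

/-- The Euler equation can be solved for the current price: the backward map of the dynamics is
globally defined. -/
theorem exists_backwardMap (hU : UtilityAssumption U) (ha : 0 < a) (hb : 0 ≤ b) (hG : 0 < G) :
    ∃ g : ℝ → ℝ, ∀ η, 0 < η → ∀ ξ,
      (0 < ξ ∧ ξ < a ∧ eulerResidual U a b G (η, ξ) = 0) ↔ ξ = g η := by
  have h : ∀ η, ∃ ξ, 0 < η → 0 < ξ ∧ ξ < a ∧ eulerResidual U a b G (η, ξ) = 0 := fun η => by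
    by_cases hη : 0 < η
    · obtain ⟨ξ, hξ⟩ := exists_eulerResidual_eq_zero hU ha hb hG hη
      exact ⟨ξ, fun _ => hξ⟩
    · exact ⟨0, fun h => absurd h hη⟩
  choose g hg using h
  refine ⟨g, fun η hη ξ => ⟨fun ⟨h1, h2, h3⟩ => ?_, ?_⟩⟩
  · obtain ⟨g1, g2, g3⟩ := hg η hη
    exact (strictAntiOn_eulerResidual hU hb hG hη).injOn ⟨h1, h2⟩ ⟨g1, g2⟩ (h3.trans g3.symm)
  · rintro rfl
    exact hg η hη

theorem hasStrictFDerivAt_eulerResidual (hG : 0 < G) {η ξ m' : ℝ} (hξ : ξ < a)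
    (hm : HasStrictDerivAt (mrs U) m' (G * (b + η) / (a - ξ))) :
    HasStrictFDerivAt (eulerResidual U a b G)
      ((G - ξ * m' * G / (a - ξ)) • ContinuousLinearMap.fst ℝ ℝ ℝ +
        (-(mrs U (G * (b + η) / (a - ξ)) + ξ * m' * (G * (b + η) / (a - ξ)) / (a - ξ))) •
          ContinuousLinearMap.snd ℝ ℝ ℝ) (η, ξ) := by
  have hy : a - ξ ≠ 0 := (sub_pos.2 hξ).ne'
  have h1 : HasStrictFDerivAt (fun v : ℝ × ℝ => v.1) (ContinuousLinearMap.fst ℝ ℝ ℝ) (η, ξ) :=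
    hasStrictFDerivAt_fst
  have h2 : HasStrictFDerivAt (fun v : ℝ × ℝ => v.2) (ContinuousLinearMap.snd ℝ ℝ ℝ) (η, ξ) :=
    hasStrictFDerivAt_snd
  have hinv := (hasStrictDerivAt_inv hy).comp_hasStrictFDerivAt (f := fun v : ℝ × ℝ => a - v.2)
    (η, ξ) (h2.const_sub a)
  have hratio := ((h1.const_add b).const_mul G).mul hinv
  have hm' : HasStrictDerivAt (mrs U) m' (G * (b + η) * (a - ξ)⁻¹) := by
    rwa [← div_eq_mul_inv]
  have hmrs := hm'.comp_hasStrictFDerivAt (η, ξ) hratio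
  have h := (h1.const_mul G).sub (h2.mul hmrs)
  have h' := h.congr_of_eventuallyEq (f₁ := eulerResidual U a b G)
    (Eventually.of_forall fun v => by simp [eulerResidual, div_eq_mul_inv])
  refine h'.congr_fderiv ?_
  ext
  · simp
    field_simp
  · simp
    field_simp
    ring

end

/-! ### Bubbly steady states -/

section

variable {U : ℝ → ℝ → ℝ} {a b G Gd D wb : ℝ} {ξs : ℝ × ℝ}

theorem IsBubblySteadyState.snd_eq_zero (h : IsBubblySteadyState U a b G Gd D ξs)
    (hG : 0 < G) (hGdG : Gd < G) : ξs.2 = 0 := by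
  have h2 : ξs.2 - Gd / G * ξs.2 = 0 := congrArg Prod.snd h.1.2.2
  have h3 : (1 - Gd / G) * ξs.2 = 0 := by linarith
  exact (mul_eq_zero.1 h3).resolve_left (sub_pos.2 ((div_lt_one hG).2 hGdG)).ne'

theorem isBubblySteadyState_iff (hU : UtilityAssumption U) (hb : 0 ≤ b) (hG : 0 < G)
    (hGdG : Gd < G) :
    IsBubblySteadyState U a b G Gd D ξs ↔
      0 < ξs.1 ∧ ξs.1 < a ∧ mrs U (G * (b + ξs.1) / (a - ξs.1)) = G ∧ ξs.2 = 0 := by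
  have key : ∀ {ξ : ℝ}, 0 < ξ →
      (eulerResidual U a b G (ξ, ξ) = 0 ↔ mrs U (G * (b + ξ) / (a - ξ)) = G) := fun {ξ} hξ => by
    rw [eulerResidual, mul_comm, ← mul_sub, mul_eq_zero, or_iff_right hξ.ne', sub_eq_zero, eq_comm]
  constructor
  · intro h
    have h2 := h.snd_eq_zero hG hGdG
    obtain ⟨h1, h0⟩ := h
    rw [solvesPhi_iff hU hb hG (by simpa [h2] using h0)] at h1
    simp only [h2, mul_zero, add_zero, key h0] at h1
    exact ⟨h0, h1.1, h1.2.1, h2⟩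
  · rintro ⟨h0, ha, hm, h2⟩
    refine ⟨(solvesPhi_iff hU hb hG (by simpa [h2] using h0)).2 ?_, h0⟩
    simpa [h2, key h0] using ⟨ha, hm⟩

theorem IsBubblySteadyState.fst_eq (hU : UtilityAssumption U) (hb : 0 ≤ b) (hG : 0 < G)
    (hGdG : Gd < G) (hw : IsUniqueThreshold U G G wb) (h : IsBubblySteadyState U a b G Gd D ξs) :
    ξs.1 = (wb * a - b) / (1 + wb) := by
  obtain ⟨h0, ha, hm, -⟩ := (isBubblySteadyState_iff hU hb hG hGdG).1 h
  have hy : 0 < a - ξs.1 := sub_pos.2 ha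
  have := hw.2 ((b + ξs.1) / (a - ξs.1)) (div_pos (by linarith) hy)
    (by rw [← mul_div_assoc]; exact hm)
  rw [div_eq_iff hy.ne'] at this
  rw [eq_div_iff (by linarith [hw.1.1])]
  linarith

theorem exists_isBubblySteadyState_iff (hU : UtilityAssumption U) (ha : 0 < a) (hb : 0 ≤ b)
    (hG : 0 < G) (hGdG : Gd < G) (hw : IsUniqueThreshold U G G wb) :
    (∃ ξs, IsBubblySteadyState U a b G Gd D ξs) ↔ b / a < wb := by
  have hw1 : 0 < 1 + wb := by linarith [hw.1.1]
  rw [div_lt_iff₀ ha]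
  constructor
  · rintro ⟨ξs, h⟩
    have h0 := h.2
    rw [h.fst_eq hU hb hG hGdG hw, div_pos_iff_of_pos_right hw1] at h0
    linarith
  · intro h
    refine ⟨((wb * a - b) / (1 + wb), 0), (isBubblySteadyState_iff hU hb hG hGdG).2
      ⟨div_pos (by linarith) hw1, (div_lt_iff₀ hw1).2 (by linarith), ?_, rfl⟩⟩
    have hy : a - (wb * a - b) / (1 + wb) = (a + b) / (1 + wb) := by field_simp; ring
    have hz : b + (wb * a - b) / (1 + wb) = wb * ((a + b) / (1 + wb)) := by field_simp; ring
    have hpos : 0 < (a + b) / (1 + wb) := div_pos (by linarith) hw1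
    rw [hy, hz, ← mul_assoc, mul_div_cancel_right₀ _ hpos.ne']
    exact hw.1.2

/-- Linearization at a bubbly steady state: the backward map fixes it and has slope `d / n`. The
inequality `d < n` excludes the slope one. -/
theorem IsBubblySteadyState.hasStrictDerivAt_backwardMap (hU : UtilityAssumption U) (hb : 0 ≤ b)
    (hG : 0 < G) (hGdG : Gd < G) (h : IsBubblySteadyState U a b G Gd D ξs) {g : ℝ → ℝ}
    (hg : ∀ η, 0 < η → ∀ ξ,
      (0 < ξ ∧ ξ < a ∧ eulerResidual U a b G (η, ξ) = 0) ↔ ξ = g η) :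
    g ξs.1 = ξs.1 ∧ HasStrictDerivAt g (dCoef U a b G ξs / nCoef U a b G ξs) ξs.1 ∧
      0 < nCoef U a b G ξs ∧ dCoef U a b G ξs < nCoef U a b G ξs := by
  obtain ⟨h0, ha, hm, -⟩ := (isBubblySteadyState_iff hU hb hG hGdG).1 h
  set ξ := ξs.1 with hξ
  have hy : 0 < a - ξ := sub_pos.2 ha
  have hz : 0 < G * (b + ξ) := mul_pos hG (by linarith)
  have hzero : eulerResidual U a b G (ξ, ξ) = 0 := by simp only [eulerResidual, hm]; ring
  set w := G * (b + ξ) / (a - ξ) with hw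
  have hw0 : 0 < w := div_pos hz hy
  have hUz := hU.Uz_pos 1 w one_pos hw0
  have hUzz := hU.Uzz_neg 1 w one_pos hw0
  have hU1 : U 1 w = (G + w) * Uz U 1 w := by
    rw [hU.euler one_pos hw0, hU.Uy_eq_mrs_mul one_pos hw0, div_one, hm]
    ring
  have hd : dCoef U a b G ξs =
      G * (Uz U 1 w + ξ * Uzz U 1 w * (G + w) / (a - ξ)) := by
    rw [dCoef, ← hξ, hU.Uz_eq hy hz, hU.Uzz_eq hy hz, hU.Uyz_eq hy hz, ← hw]
    ring
  have hn : nCoef U a b G ξs =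
      G * Uz U 1 w - ξ * w * Uzz U 1 w * (G + w) / (a - ξ) := by
    rw [nCoef, ← hξ, hU.Uy_eq_mrs_mul hy hz, hU.Uz_eq hy hz, hU.Uyy_eq hy hz, hU.Uyz_eq hy hz,
      ← hw, hm]
    ring
  have hneg : ξ * Uzz U 1 w * (G + w) / (a - ξ) < 0 :=
    div_neg_of_neg_of_pos (mul_neg_of_neg_of_pos (mul_neg_of_pos_of_neg h0 hUzz) (by linarith)) hy
  have hn' : nCoef U a b G ξs = G * Uz U 1 w - w * (ξ * Uzz U 1 w * (G + w) / (a - ξ)) := by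
    rw [hn]; ring
  have hn0 : 0 < nCoef U a b G ξs := by
    rw [hn']
    nlinarith [mul_pos hG hUz, mul_pos hw0 (neg_pos.2 hneg)]
  refine ⟨((hg ξ h0 ξ).1 ⟨h0, ha, hzero⟩).symm, ?_, hn0, ?_⟩
  · have hF := hasStrictFDerivAt_eulerResidual (a := a) hG ha (hU.hasStrictDerivAt_mrs hw0)
    rw [← hw, hm, hU1] at hF
    -- Up to the factor `U_z > 0`, the partial derivatives of the residual are `d` and `-n`.
    have hp : G - ξ * (-((G + w) * Uz U 1 w * Uzz U 1 w) / Uz U 1 w ^ 2) * G / (a - ξ) =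
        dCoef U a b G ξs / Uz U 1 w := by
      rw [hd]; field_simp; ring
    have hq : -(G + ξ * (-((G + w) * Uz U 1 w * Uzz U 1 w) / Uz U 1 w ^ 2) * w / (a - ξ)) =
        -(nCoef U a b G ξs / Uz U 1 w) := by
      rw [hn]; field_simp; ring
    rw [hp, hq] at hF
    obtain ⟨ψ, hψ, hψ0, hψF⟩ := exists_implicit_of_hasStrictFDerivAt hF
      (neg_ne_zero.2 (div_pos hn0 hUz).ne')
    have hψ' : HasStrictDerivAt ψ (dCoef U a b G ξs / nCoef U a b G ξs) ξ :=
      hψ.congr_deriv (by field_simp)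
    refine hψ'.congr_of_eventuallyEq ?_
    have hrange : ∀ᶠ x in 𝓝 ξ, ψ x ∈ Set.Ioo 0 a :=
      hψ'.hasDerivAt.continuousAt.eventually (by
        rw [show ψ ξ = ξ from hψ0]
        exact Ioo_mem_nhds h0 ha)
    filter_upwards [hψF, hrange, Ioi_mem_nhds h0] with x hx1 hx2 hx3
    exact (hg x hx3 _).1 ⟨hx2.1, hx2.2, hx1.trans hzero⟩
  · rw [hd, hn']
    nlinarith [mul_pos hG (neg_pos.2 hneg), mul_pos hw0 (neg_pos.2 hneg)]

end

/-! ### Equilibria and paths -/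

section

variable {U : ℝ → ℝ → ℝ} {a b G Gd D : ℝ}

/-- The first-order condition characterizes the optimality of holding one unit of the asset. -/
theorem forall_portfolio_le_iff (hU : UtilityAssumption U) {e f p Q : ℝ} (hy : 0 < e - p)
    (hz : 0 < f + Q) :
    (∀ x, 0 < e - p * x → 0 < f + Q * x → U (e - p * x) (f + Q * x) ≤ U (e - p) (f + Q)) ↔
      Q * Uz U (e - p) (f + Q) = p * Uy U (e - p) (f + Q) := by
  have hw : 0 < (f + Q) / (e - p) := div_pos hz hy
  constructor
  · intro hmax
    have hc1 : HasDerivAt (fun x => e - p * x) (-p) 1 := by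
      simpa using ((hasDerivAt_id (1 : ℝ)).const_mul p).const_sub e
    have hc2 : HasDerivAt (fun x => f + Q * x) Q 1 := by
      simpa using ((hasDerivAt_id (1 : ℝ)).const_mul Q).const_add f
    have hratio := hc2.div hc1 (by simpa using hy.ne')
    have hf : HasDerivAt (fun s => U 1 s) (Uz U 1 ((f + Q) / (e - p)))
        ((f + Q * 1) / (e - p * 1)) := by
      simpa using hU.hasDerivAt_ratio hw
    have h := hc1.mul (HasDerivAt.comp (h₂ := fun s => U 1 s) 1 hf hratio)
    have hpos1 : ∀ᶠ x in 𝓝 (1 : ℝ), 0 < e - p * x :=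
      hc1.continuousAt.eventually_const_lt (by simpa using hy)
    have hpos2 : ∀ᶠ x in 𝓝 (1 : ℝ), 0 < f + Q * x :=
      hc2.continuousAt.eventually_const_lt (by simpa using hz)
    have hφ := h.congr_of_eventuallyEq (f₁ := fun x => U (e - p * x) (f + Q * x)) (by
      filter_upwards [hpos1, hpos2] with x h1 h2
      exact hU.eq_mul_ratio h1 h2)
    have hloc : IsLocalMax (fun x => U (e - p * x) (f + Q * x)) 1 := by
      filter_upwards [hpos1, hpos2] with x h1 h2
      simpa using hmax x h1 h2
    have h0 := hloc.hasDerivAt_eq_zero hφ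
    rw [hU.Uy_eq hy hz, hU.Uz_eq hy hz]
    simp only [Function.comp_apply, Pi.div_apply, mul_one] at h0
    field_simp at h0 ⊢
    linarith
  · intro hfoc x h1 h2
    refine (hU.le_supergradient hy hz h1 h2).trans_eq ?_
    rw [hU.euler hy hz]
    linear_combination (x - 1) * hfoc

theorem isEquilibriumPrice_iff_isPath (hU : UtilityAssumption U) (hb : 0 ≤ b) (hGd : 0 < Gd)
    (hG : 0 < G) (hD : 0 < D) (P : ℕ → ℝ) :
    IsEquilibriumPrice U a b G Gd D P ↔
      IsPath U a b G Gd D (fun t => (P t / G ^ t, (Gd / G) ^ t)) := by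
  have hGt : ∀ t : ℕ, 0 < G ^ t := fun t => pow_pos hG t
  have hdiv : ∀ t : ℕ, 0 < D * Gd ^ t := fun t => mul_pos hD (pow_pos hGd t)
  have hy : ∀ t, a * G ^ t - P t = G ^ t * (a - P t / G ^ t) := fun t => by
    have := hGt t; field_simp
  have hz : ∀ t, b * G ^ (t + 1) + (P (t + 1) + D * Gd ^ (t + 1)) =
      G ^ t * (G * (b + P (t + 1) / G ^ (t + 1) + D * (Gd / G) ^ (t + 1))) := fun t => by
    have := hGt t
    rw [div_pow, pow_succ G t]; field_simp; ring
  -- The first-order condition of generation `t`, before and after detrending.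
  have key : ∀ t, (∀ t, 0 < P t) → 0 < a - P t / G ^ t →
      ((P (t + 1) + D * Gd ^ (t + 1)) * Uz U (a * G ^ t - P t)
          (b * G ^ (t + 1) + (P (t + 1) + D * Gd ^ (t + 1))) =
        P t * Uy U (a * G ^ t - P t) (b * G ^ (t + 1) + (P (t + 1) + D * Gd ^ (t + 1))) ↔
      Phi U a b G Gd D (P t / G ^ t, (Gd / G) ^ t)
        (P (t + 1) / G ^ (t + 1), (Gd / G) ^ (t + 1)) = 0) := fun t hP hya => by
    have h1 : 0 < P (t + 1) / G ^ (t + 1) := div_pos (hP _) (hGt _)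
    have h2 : 0 < D * (Gd / G) ^ (t + 1) := mul_pos hD (pow_pos (div_pos hGd hG) _)
    have hz0 : 0 < G * (b + P (t + 1) / G ^ (t + 1) + D * (Gd / G) ^ (t + 1)) :=
      mul_pos hG (by linarith)
    have hy1 := mul_pos (hGt t) hya
    have hz1 := mul_pos (hGt t) hz0
    have hsnd : (Gd / G) ^ (t + 1) - Gd / G * (Gd / G) ^ t = 0 := by ring
    rw [Phi, Prod.mk_eq_zero, and_iff_left hsnd, hy, hz, hU.Uz_eq hy1 hz1, hU.Uy_eq_one hy1 hz1,
      mul_div_mul_left _ _ (hGt t).ne', ← hU.Uz_eq hya hz0, ← hU.Uy_eq_one hya hz0]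
    simp only [youngArg, oldArg]
    have hP1 : P (t + 1) + D * Gd ^ (t + 1) =
        G ^ t * (G * (P (t + 1) / G ^ (t + 1) + D * (Gd / G) ^ (t + 1))) := by
      have := hGt t
      rw [div_pow, pow_succ G t]; field_simp
    have hP0 : ∀ B, P t * B = G ^ t * (P t / G ^ t * B) := fun B => by
      rw [← mul_assoc, mul_div_cancel₀ _ (hGt t).ne']
    rw [hP1, sub_eq_zero, mul_assoc (G ^ t), hP0, mul_right_inj' (hGt t).ne']
  constructor
  · rintro ⟨x, y, z, h⟩ t
    have hyt : ∀ t, y t = a * G ^ t - P t := fun t => by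
      have := h.budget_young t
      rw [h.asset_market] at this
      linarith
    have hzt : ∀ t, z (t + 1) = b * G ^ (t + 1) + (P (t + 1) + D * Gd ^ (t + 1)) := fun t => by
      have := h.budget_old t
      rwa [h.asset_market, mul_one] at this
    have hy0 := h.young_pos t
    have hz0 := h.old_pos (t + 1)
    have hopt := h.optimal t
    rw [hyt] at hy0 hopt
    rw [hzt] at hz0 hopt
    have hya : 0 < a - P t / G ^ t := by
      rw [hy] at hy0
      exact pos_of_mul_pos_right hy0 (hGt t).le
    refine ⟨div_pos (h.price_pos t) (hGt t), rfl, hya, ?_,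
      (key t h.price_pos hya).1 ((forall_portfolio_le_iff hU hy0 hz0).1 hopt)⟩
    rw [hz] at hz0
    exact pos_of_mul_pos_right hz0 (hGt t).le
  · intro h
    have hP : ∀ t, 0 < P t := fun t => (div_pos_iff_of_pos_right (hGt t)).1 (h t).1
    have hy0 : ∀ t, 0 < a * G ^ t - P t := fun t => by
      rw [hy]
      exact mul_pos (hGt t) (h t).2.2.1
    have hz0 : ∀ t, 0 < b * G ^ t + (P t + D * Gd ^ t) := fun t => by
      have := mul_nonneg hb (hGt t).le
      linarith [hP t, hdiv t]
    exact ⟨fun _ => 1, fun t => a * G ^ t - P t, fun t => b * G ^ t + (P t + D * Gd ^ t),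
      { price_pos := hP
        young_pos := hy0
        old_pos := hz0
        budget_young := fun t => by ring
        budget_old := fun t => by ring
        budget_initial_old := rfl
        optimal := fun t => (forall_portfolio_le_iff hU (hy0 t) (hz0 (t + 1))).2
          ((key t hP (h t).2.2.1).2 (h t).2.2.2.2)
        asset_market := fun _ => rfl
        goods_market := fun t => by ring }⟩

/-- Paths are the positive orbits of the backward map perturbed by the detrended dividends. -/
theorem isPath_iff (hU : UtilityAssumption U) (hb : 0 ≤ b) (hG : 0 < G) (hGd : 0 < Gd)
    (hD : 0 < D) {g : ℝ → ℝ} (hg : ∀ η, 0 < η → ∀ ξ,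
      (0 < ξ ∧ ξ < a ∧ eulerResidual U a b G (η, ξ) = 0) ↔ ξ = g η) (ξ : ℕ → ℝ × ℝ) :
    IsPath U a b G Gd D ξ ↔ (∀ t, (ξ t).2 = (Gd / G) ^ t) ∧ (∀ t, 0 < (ξ t).1) ∧
      ∀ t, (ξ t).1 = g ((ξ (t + 1)).1 + D * (Gd / G) ^ (t + 1)) := by
  have hu : ∀ t : ℕ, 0 < D * (Gd / G) ^ t := fun t => mul_pos hD (pow_pos (div_pos hGd hG) t)
  constructor
  · intro h
    refine ⟨fun t => (h t).2.1, fun t => (h t).1, fun t => ?_⟩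
    have hη : 0 < (ξ (t + 1)).1 + D * (ξ (t + 1)).2 := by
      rw [(h (t + 1)).2.1]
      exact add_pos (h (t + 1)).1 (hu _)
    obtain ⟨h1, h2, -⟩ := (solvesPhi_iff hU hb hG hη).1 (h t).2.2
    have := (hg _ hη _).1 ⟨(h t).1, h1, h2⟩
    rwa [(h (t + 1)).2.1] at this
  · rintro ⟨h2, h0, h1⟩ t
    have hη : 0 < (ξ (t + 1)).1 + D * (ξ (t + 1)).2 := by
      rw [h2]
      exact add_pos (h0 _) (hu _)
    refine ⟨h0 t, h2 t, (solvesPhi_iff hU hb hG hη).2 ?_⟩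
    have := (hg _ hη (ξ t).1).2 (by rw [h2]; exact h1 t)
    exact ⟨this.2.1, this.2.2, by rw [h2, h2]; ring⟩

/-! ### Existence and uniqueness of convergent paths -/

/-- The case distinction is on the size of the slope `d / n` of the backward map, which is less
than `1` and by assumption not `-1`. -/
theorem exists_isPath_tendsto (hU : UtilityAssumption U) (ha : 0 < a) (hb : 0 ≤ b)
    (hGd : 0 < Gd) (hGdG : Gd < G) (hD : 0 < D) {ξs : ℝ × ℝ}
    (hs : IsBubblySteadyState U a b G Gd D ξs) (hdn : dCoef U a b G ξs ≠ -nCoef U a b G ξs) :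
    ∃ ξ : ℕ → ℝ × ℝ, IsPath U a b G Gd D ξ ∧ Tendsto ξ atTop (𝓝 ξs) := by
  have hG : 0 < G := hGd.trans hGdG
  obtain ⟨g, hg⟩ := exists_backwardMap hU ha hb hG
  obtain ⟨hgx, hg', hn, hdlt⟩ := hs.hasStrictDerivAt_backwardMap hU hb hG hGdG hg
  set d := dCoef U a b G ξs
  set n := nCoef U a b G ξs
  set x := ξs.1 with hx
  have hx0 : 0 < x := hs.2
  set r := Gd / G with hr
  have hr0 : 0 < r := div_pos hGd hG
  have hr1 : r < 1 := (div_lt_one hG).2 hGdG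
  have hu : ∀ t : ℕ, 0 ≤ D * r ^ t := fun t => (mul_pos hD (pow_pos hr0 t)).le
  have hutend : Tendsto (fun t : ℕ => D * r ^ t) atTop (𝓝 0) := by
    simpa using (tendsto_pow_atTop_nhds_zero_of_lt_one hr0.le hr1).const_mul D
  -- It suffices to find a positive orbit of the backward map from some date on.
  suffices htail : ∃ (T : ℕ) (s : ℕ → ℝ), (∀ t, 0 < s t) ∧
      (∀ t, s t = g (s (t + 1) + D * r ^ (T + t + 1))) ∧ Tendsto s atTop (𝓝 x) by
    obtain ⟨T, s', h0, h1, hlim⟩ := htail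
    obtain ⟨s, hs0, hs1, hs2⟩ := exists_extend_backward (g := g) (u := fun t => D * r ^ t)
      (fun p hp => ((hg p hp _).2 rfl).1) hu T s' h0 h1
    refine ⟨fun t => (s t, r ^ t), (isPath_iff hU hb hG hGd hD hg _).2
      ⟨fun _ => rfl, hs0, hs1⟩, ?_⟩
    have hlim' : Tendsto s atTop (𝓝 x) := by
      refine (tendsto_add_atTop_iff_nat T).1 (hlim.congr fun t => ?_)
      rw [add_comm, hs2]
    have h2 := hs.snd_eq_zero hG hGdG
    have : ξs = (x, 0) := Prod.ext rfl h2
    rw [this]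
    exact hlim'.prodMk_nhds (tendsto_pow_atTop_nhds_zero_of_lt_one hr0.le hr1)
  have hshift : ∀ {c : ℝ}, 0 < c → ∃ T : ℕ, D * r ^ T < c := fun hc =>
    (hutend.eventually_lt_const hc).exists
  rcases lt_or_ge (-n) d with hd | hd
  · -- The backward map contracts.
    have hslope : |d / n| < 1 := by
      rw [abs_div, abs_of_pos hn, div_lt_one hn, abs_lt]
      exact ⟨hd, hdlt⟩
    obtain ⟨k, hk, hk1⟩ := exists_between hslope
    have hk0 : 0 ≤ k := (abs_nonneg _).trans hk.le
    have hk' : 0 < 1 - k := sub_pos.2 hk1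
    obtain ⟨δ, hlip, hδ0, hδx⟩ := ((exists_abs_sub_le_of_hasStrictDerivAt hg' hk).and
      (Ioo_mem_nhdsGT hx0)).exists
    obtain ⟨T, hT⟩ := hshift (mul_pos hk' hδ0)
    have hanti : Antitone fun t : ℕ => D * r ^ (T + t) := fun i j hij =>
      mul_le_mul_of_nonneg_left (pow_le_pow_of_le_one hr0.le hr1.le (by omega)) hD.le
    obtain ⟨s, hs⟩ := exists_backward_orbit (u := fun t => D * r ^ (T + t)) hk0 hk1 hgx hlip
      (fun t => hu _) hanti (by
        rw [add_zero, div_le_iff₀ hk', mul_comm δ]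
        exact hT.le)
    have hdist : ∀ t, |s t - x| < x := fun t => by
      have h1 := (hs t).2
      have h2 : D * r ^ (T + t) ≤ (1 - k) * δ := (hanti (Nat.zero_le t)).trans hT.le
      have h3 : k / (1 - k) * (D * r ^ (T + t)) ≤ k / (1 - k) * ((1 - k) * δ) :=
        mul_le_mul_of_nonneg_left h2 (div_nonneg hk0 hk'.le)
      have h4 : k / (1 - k) * ((1 - k) * δ) = k * δ := by field_simp
      nlinarith
    refine ⟨T, s, fun t => ?_, fun t => (hs t).1, ?_⟩
    · linarith [(abs_lt.1 (hdist t)).1]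
    · rw [tendsto_iff_dist_tendsto_zero]
      have h0 : Tendsto (fun t => k / (1 - k) * (D * r ^ (T + t))) atTop (𝓝 0) := by
        have := (hutend.comp (tendsto_add_atTop_nat T)).const_mul (k / (1 - k))
        simpa [Function.comp_def, add_comm] using this
      exact squeeze_zero (fun _ => dist_nonneg) (fun t => (hs t).2) h0
  · -- The backward map expands with slope below `-1`, so that its local inverse contracts.
    have hd' : d < -n := lt_of_le_of_ne hd hdn
    have hd0 : d < 0 := by linarith
    have hne : d / n ≠ 0 := (div_neg_of_neg_of_pos hd0 hn).ne
    have hslope : |(d / n)⁻¹| < 1 := by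
      rw [inv_div, abs_div, abs_of_pos hn, abs_of_neg hd0, div_lt_one (by linarith)]
      linarith
    obtain ⟨k, hk, hk1⟩ := exists_between (max_lt hslope hr1)
    have hk' : 0 < 1 - k := sub_pos.2 hk1
    set h := hg'.localInverse g _ x hne with hh
    have hinv : HasStrictDerivAt h (d / n)⁻¹ x := by
      have := hg'.to_localInverse hne
      rwa [hgx] at this
    have hright : ∀ᶠ p in 𝓝 x, g (h p) = p := by
      have := hg'.eventually_right_inverse hne
      rwa [hgx] at this
    have hhx : h x = x := by
      have := (hg'.eventually_left_inverse hne).self_of_nhds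
      rwa [hgx] at this
    obtain ⟨ε, hε, hball⟩ := Metric.eventually_nhds_iff.1 hright
    obtain ⟨δ, hlip, hδ0, hδ⟩ := ((exists_abs_sub_le_of_hasStrictDerivAt hinv
      ((le_max_left _ _).trans_lt hk)).and (Ioo_mem_nhdsGT (lt_min hx0 hε))).exists
    obtain ⟨T, hT⟩ := hshift (mul_pos hk' hδ0)
    obtain ⟨s, hs1, hs2, hs3⟩ := exists_forward_orbit (h := h) (x := x) (δ := δ)
      (u := fun t => D * r ^ (T + t)) hr0.le
      ((le_max_right _ _).trans_lt hk) hk1 (fun p hp => by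
        have := hlip p x hp (by simpa using hδ0.le)
        rwa [hhx] at this)
      (fun t => hu _) (fun t => by ring) (by simpa using hT.le)
    refine ⟨T, s, fun t => ?_, fun t => ?_, hs3⟩
    · have := (abs_le.1 (hs2 t)).1
      linarith [hδ.trans_le (min_le_left _ _)]
    · have h1 := hs1 t
      simp only [← add_assoc] at h1
      rw [h1, hball]
      exact (hs2 t).trans_lt (hδ.trans_le (min_le_right _ _))

/-- Positivity of `d` puts the slope of the backward map between `0` and `1`. -/
theorem isPath_tendsto_unique (hU : UtilityAssumption U) (ha : 0 < a) (hb : 0 ≤ b)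
    (hGd : 0 < Gd) (hGdG : Gd < G) (hD : 0 < D) {ξs : ℝ × ℝ}
    (hs : IsBubblySteadyState U a b G Gd D ξs) (hd : 0 < dCoef U a b G ξs) {ξ ξ' : ℕ → ℝ × ℝ}
    (h : IsPath U a b G Gd D ξ) (h' : IsPath U a b G Gd D ξ') (hξ : Tendsto ξ atTop (𝓝 ξs))
    (hξ' : Tendsto ξ' atTop (𝓝 ξs)) : ξ = ξ' := by
  have hG : 0 < G := hGd.trans hGdG
  obtain ⟨g, hg⟩ := exists_backwardMap hU ha hb hG
  obtain ⟨-, hg', hn, hdlt⟩ := hs.hasStrictDerivAt_backwardMap hU hb hG hGdG hg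
  have hslope : |dCoef U a b G ξs / nCoef U a b G ξs| < 1 := by
    rwa [abs_of_pos (div_pos hd hn), div_lt_one hn]
  obtain ⟨k, hk, hk1⟩ := exists_between hslope
  obtain ⟨δ, hlip, hδ⟩ := ((exists_abs_sub_le_of_hasStrictDerivAt hg' hk).and
    self_mem_nhdsWithin).exists
  obtain ⟨h2, -, h1⟩ := (isPath_iff hU hb hG hGd hD hg _).1 h
  obtain ⟨h2', -, h1'⟩ := (isPath_iff hU hb hG hGd hD hg _).1 h'
  have hu : Tendsto (fun t : ℕ => D * (Gd / G) ^ t) atTop (𝓝 0) := by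
    simpa using (tendsto_pow_atTop_nhds_zero_of_lt_one (div_pos hGd hG).le
      ((div_lt_one hG).2 hGdG)).const_mul D
  have hev := eventually_eq_of_backward_orbit ((abs_nonneg _).trans hk.le) hk1 hδ hlip hu
    ((continuous_fst.tendsto ξs).comp hξ) ((continuous_fst.tendsto ξs).comp hξ') h1 h1'
  obtain ⟨T, hT⟩ := eventually_atTop.1 hev
  have hback : ∀ m t, T ≤ t + m → (ξ t).1 = (ξ' t).1 := by
    intro m
    induction m with
    | zero => exact fun t ht => hT t ht
    | succ m ih => exact fun t ht => by rw [h1, h1', ih (t + 1) (by omega)]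
  exact funext fun t => Prod.ext (hback T t (by omega)) ((h2 t).trans (h2' t).symm)

end

/-! ### Bubbles -/

/-- If the dividend yields `δ t / P t` are summable then there is a bubble at every date. The
present value `q_t P_t` of the price falls by `q_{t+1} δ_{t+1}` from one date to the next, so that
the bubble is its limit over `q_t`; this limit is positive since the total proportional loss is
finite. -/
theorem hasBubbleAt_of_summable {P δ : ℕ → ℝ} (hP : ∀ t, 0 < P t) (hδ : ∀ t, 0 ≤ δ t)
    (hsum : Summable fun t => δ t / P t) (t : ℕ) : HasBubbleAt P δ t := by
  have hR : ∀ t, 0 < riskFreeRate P δ t := fun t =>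
    div_pos (add_pos_of_pos_of_nonneg (hP _) (hδ _)) (hP t)
  have hq : ∀ t, 0 < adPrice P δ t := fun t =>
    one_div_pos.2 (Finset.prod_pos fun s _ => hR s)
  have hqR : ∀ t, adPrice P δ (t + 1) * (P (t + 1) + δ (t + 1)) = adPrice P δ t * P t := fun t => by
    have h1 := (Finset.prod_pos fun s (_ : s ∈ Finset.range t) => hR s).ne'
    have h2 := (hP t).ne'
    have h3 := (add_pos_of_pos_of_nonneg (hP (t + 1)) (hδ (t + 1))).ne'
    have h4 : riskFreeRate P δ t = (P (t + 1) + δ (t + 1)) / P t := rfl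
    rw [adPrice, adPrice, Finset.prod_range_succ, h4]
    field_simp
  set A : ℕ → ℝ := fun n => adPrice P δ (t + n) * P (t + n) with hA
  have hApos : ∀ n, 0 < A n := fun n => mul_pos (hq _) (hP _)
  have hterm : ∀ n, adPrice P δ (t + 1 + n) * δ (t + 1 + n) = A n - A (n + 1) := fun n => by
    have := hqR (t + n)
    simp only [hA, add_right_comm t 1 n, ← add_assoc]
    linarith
  have hnonneg : ∀ n, 0 ≤ adPrice P δ (t + 1 + n) * δ (t + 1 + n) := fun n =>
    mul_nonneg (hq _).le (hδ _)
  have hanti : Antitone A := antitone_nat_of_succ_le fun n => by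
    linarith [hnonneg n, hterm n]
  set S := ∑' s, δ (s + (t + 1)) / P (s + (t + 1)) with hS
  have hsum' : Summable fun s => δ (s + (t + 1)) / P (s + (t + 1)) :=
    (summable_nat_add_iff (f := fun s => δ s / P s) (t + 1)).2 hsum
  have hlower : ∀ n, A 0 * Real.exp (-∑ s ∈ Finset.range n,
      δ (s + (t + 1)) / P (s + (t + 1))) ≤ A n := by
    intro n
    induction n with
    | zero => simp
    | succ n ih =>
      set y := δ (n + (t + 1)) / P (n + (t + 1)) with hy
      have hstep : A n = A (n + 1) * (1 + y) := by
        have h1 := hqR (t + n)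
        have h2 := (hP (t + n + 1)).ne'
        have h3 : n + (t + 1) = t + n + 1 := by omega
        simp only [hA, hy, h3, ← add_assoc]
        rw [← h1]
        field_simp
      rw [Finset.sum_range_succ, neg_add, Real.exp_add, ← mul_assoc, Real.exp_neg y,
        ← div_eq_mul_inv, div_le_iff₀ (Real.exp_pos y)]
      refine ih.trans (hstep.le.trans (mul_le_mul_of_nonneg_left ?_ (hApos _).le))
      linarith [Real.add_one_le_exp y]
  have hlower' : ∀ n, A 0 * Real.exp (-S) ≤ A n := fun n => by
    refine le_trans (mul_le_mul_of_nonneg_left (Real.exp_le_exp.2 (neg_le_neg ?_)) (hApos 0).le)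
      (hlower n)
    exact hsum'.sum_le_tsum _ fun s _ => div_nonneg (hδ _) (hP _).le
  have hlim : Tendsto A atTop (𝓝 (⨅ n, A n)) :=
    tendsto_atTop_ciInf hanti ⟨_, by rintro _ ⟨n, rfl⟩; exact hlower' n⟩
  have hlim0 : 0 < ⨅ n, A n :=
    (mul_pos (hApos 0) (Real.exp_pos _)).trans_le (le_ciInf hlower')
  have hhas : HasSum (fun n => adPrice P δ (t + 1 + n) * δ (t + 1 + n)) (A 0 - ⨅ n, A n) := by
    rw [hasSum_iff_tendsto_nat_of_nonneg hnonneg]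
    simp only [hterm, Finset.sum_range_sub']
    exact hlim.const_sub (A 0)
  refine ⟨hhas.summable, ?_⟩
  rw [fundamentalValue, hhas.tsum_eq, one_div, inv_mul_lt_iff₀ (hq t)]
  simpa [hA] using hlim0

theorem IsPath.hasBubbleAt {U : ℝ → ℝ → ℝ} {a b G Gd D : ℝ} (hGd : 0 < Gd) (hGdG : Gd < G)
    (hD : 0 < D) {ξs : ℝ × ℝ} (hs : 0 < ξs.1) {ξ : ℕ → ℝ × ℝ} (h : IsPath U a b G Gd D ξ)
    (hξ : Tendsto ξ atTop (𝓝 ξs)) (t : ℕ) :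
    HasBubbleAt (fun t => (ξ t).1 * G ^ t) (fun t => D * Gd ^ t) t := by
  have hG : 0 < G := hGd.trans hGdG
  refine hasBubbleAt_of_summable (fun t => mul_pos (h t).1 (pow_pos hG t))
    (fun t => (mul_pos hD (pow_pos hGd t)).le) ?_ t
  have hfst : Tendsto (fun t => (ξ t).1) atTop (𝓝 ξs.1) := (continuous_fst.tendsto ξs).comp hξ
  -- Eventually the detrended price exceeds half its limit; the yields are then dominated by a
  -- geometric series.
  have hgeo : Summable fun t : ℕ => 2 * D / ξs.1 * (Gd / G) ^ t :=
    (summable_geometric_of_lt_one (div_pos hGd hG).le ((div_lt_one hG).2 hGdG)).mul_left _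
  refine hgeo.of_norm_bounded_eventually_nat ?_
  filter_upwards [hfst.eventually_const_lt (half_lt_self hs)] with t ht
  have hr := pow_pos (div_pos hGd hG) t
  have hx := (h t).1
  have heq : D * Gd ^ t / ((ξ t).1 * G ^ t) = D / (ξ t).1 * (Gd / G) ^ t := by
    rw [div_pow, div_mul_div_comm]
  rw [heq, Real.norm_of_nonneg (mul_pos (div_pos hD hx) hr).le]
  refine mul_le_mul_of_nonneg_right ?_ hr.le
  rw [div_le_div_iff₀ hx hs]
  nlinarith

end OLG

theorem mainTheorem2 (U : ℝ → ℝ → ℝ) (a b G Gd D : ℝ) (hU : OLG.UtilityAssumption U)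
    (ha : 0 < a) (hb : 0 ≤ b) (hGd : 0 < Gd) (hGdG : Gd < G) (hD : 0 < D) :
    ∃ wf wb : ℝ,
      OLG.IsUniqueThreshold U G Gd wf ∧ OLG.IsUniqueThreshold U G G wb ∧ wf < wb ∧
      ((∃ ξs : ℝ × ℝ, OLG.IsBubblySteadyState U a b G Gd D ξs) ↔ b / a < wb) ∧
      -- equilibria correspond exactly to paths of the detrended system
      (∀ P : ℕ → ℝ, OLG.IsEquilibriumPrice U a b G Gd D P ↔
        OLG.IsPath U a b G Gd D (fun t => (P t / G ^ t, (Gd / G) ^ t))) ∧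
      (b / a < wb → ∀ ξs : ℝ × ℝ, OLG.IsBubblySteadyState U a b G Gd D ξs →
        (OLG.dCoef U a b G ξs ≠ 0 → OLG.dCoef U a b G ξs ≠ -OLG.nCoef U a b G ξs →
          ∃ ξ : ℕ → ℝ × ℝ, OLG.IsPath U a b G Gd D ξ ∧ Tendsto ξ atTop (𝓝 ξs)) ∧
        (0 < OLG.dCoef U a b G ξs →
          ∃! ξ : ℕ → ℝ × ℝ, OLG.IsPath U a b G Gd D ξ ∧ Tendsto ξ atTop (𝓝 ξs)) ∧
        (∀ ξ : ℕ → ℝ × ℝ, OLG.IsPath U a b G Gd D ξ → Tendsto ξ atTop (𝓝 ξs) →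
          OLG.IsEquilibriumPrice U a b G Gd D (fun t => (ξ t).1 * G ^ t) ∧
          (fun t : ℕ => (ξ t).1 * G ^ t) ~[atTop]
            (fun t : ℕ => (wb * a - b) / (1 + wb) * G ^ t) ∧
          ∀ t, OLG.HasBubbleAt (fun t => (ξ t).1 * G ^ t) (fun t => D * Gd ^ t) t)) := by
  have hG : 0 < G := hGd.trans hGdG
  obtain ⟨wf, hwf⟩ := hU.exists_isUniqueThreshold hG hGd
  obtain ⟨wb, hwb⟩ := hU.exists_isUniqueThreshold hG hG
  have hlt : wf < wb := by
    have h : OLG.mrs U (G * wf) < OLG.mrs U (G * wb) := by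
      rw [OLG.mrs, OLG.mrs, hwf.1.2, hwb.1.2]
      exact hGdG
    exact lt_of_mul_lt_mul_left ((hU.strictMonoOn_mrs.lt_iff_lt
      (Set.mem_Ioi.2 (mul_pos hG hwf.1.1)) (Set.mem_Ioi.2 (mul_pos hG hwb.1.1))).1 h) hG.le
  refine ⟨wf, wb, hwf, hwb, hlt, OLG.exists_isBubblySteadyState_iff hU ha hb hG hGdG hwb,
    OLG.isEquilibriumPrice_iff_isPath hU hb hGd hG hD, fun _ ξs hs => ⟨fun _ hdn =>
      OLG.exists_isPath_tendsto hU ha hb hGd hGdG hD hs hdn, fun hd => ?_, fun ξ h hξ =>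
      ⟨?_, ?_, h.hasBubbleAt hGd hGdG hD hs.2 hξ⟩⟩⟩
  · have hn := (hs.hasStrictDerivAt_backwardMap hU hb hG hGdG
      (OLG.exists_backwardMap hU ha hb hG).choose_spec).2.2.1
    obtain ⟨ξ, h, hξ⟩ := OLG.exists_isPath_tendsto hU ha hb hGd hGdG hD hs (by linarith)
    exact ⟨ξ, ⟨h, hξ⟩, fun ξ' h' =>
      OLG.isPath_tendsto_unique hU ha hb hGd hGdG hD hs hd h'.1 h h'.2 hξ⟩
  · rw [OLG.isEquilibriumPrice_iff_isPath hU hb hGd hG hD]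
    convert h using 2 with t
    exact Prod.ext (mul_div_cancel_right₀ _ (pow_pos hG t).ne') (h t).2.1.symm
  · rw [← hs.fst_eq hU hb hG hGdG hwb]
    have hfst : Tendsto (fun t => (ξ t).1) atTop (𝓝 ξs.1) := (continuous_fst.tendsto ξs).comp hξ
    exact ((isEquivalent_const_iff_tendsto hs.2.ne').2 hfst).mul IsEquivalent.refl
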